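/- Let $d \in \mathbb{N}$, let $m > 0$ be real, and let $f : \mathbb{R}^d \to \mathbb{R}$ be $1$-periodic, i.e. $f(x+k) = f(x)$ for all $x \in \mathbb{R}^d$, $k \in \mathbb{Z}^d$. Assume that $f$ is $(m + d/2 + 2)$-times continuously differentiable (if $m + d/2$ is not an integer: $\lceil m + d/2 + 2 \rceil$-times). Let $c_* = \min_{x} f(x)$ be its global minimum, and assume that $f$ has only finitely many minimizers in $[0,1]^d$ and that the Hessian of $f$ is positive definite at each of them. For $k \in \mathbb{Z}^d$ write $|k| = \sum_{j=1}^d |k_j|$ and $e_k(x) = e^{-2\pi i k^\top x}$. For a continuous $1$-periodic $u : \mathbb{R}^d \to \mathbb{C}$ put $\widehat{u}_k = \int_{[0,1]^d} e_k(x)\, u(x)\, dx$ and $\|u\|_F = \sum_{k \in \mathbb{Z}^d} |\widehat{u}_k| \in [0,\infty]$. For $t \in \mathbb{N} = \{0,1,2,\dots\}$ let $\phi_t(x) = (e_k(x))_{|k| \le t} \in \mathbb{C}^n$ with $n = \#\{k \in \mathbb{Z}^d : |k| \le t\}$, and let $$\mathcal{G}_t = \{\, x \mapsto \phi_t(x)^*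 A\, \phi_t(x) \;:\; A \in \mathbb{C}^{n\times n} \text{ Hermitian positive semidefinite} \,\}.$$ Then there is a constant $C_f > 0$, depending only on $f$, $m$ and $d$, such that the minimum $\min_{g \in \mathcal{G}_t} \|f - c_* - g\|_F$ is attained for every $t \in \mathbb{N}$, and $$\min_{g \in \mathcal{G}_t} \|f - c_* - g\|_F \;\le\; C_f\, t^{-m} \qquad \text{for every } t \ge 1.$$ -/

import Mathlib

open scoped ENNReal ComplexOrder

namespace PeriodicPSD

/-- The unit cube `[0,1]^d`. -/
def cube (d : ℕ) : Set (Fin d → ℝ) := Set.Icc 0 1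

/-- `f` is 1-periodic: `f (x + k) = f x` for every integer vector `k`. -/
def IsPeriodic {d : ℕ} {E : Type*} (f : (Fin d → ℝ) → E) : Prop :=
  ∀ (x : Fin d → ℝ) (k : Fin d → ℤ), f (x + fun j => (k j : ℝ)) = f x

/-- The Fourier component `e_k(x) = exp (-2πi kᵀx)`. -/
noncomputable def e {d : ℕ} (k : Fin d → ℤ) (x : Fin d → ℝ) : ℂ :=
  Complex.exp (-2 * Real.pi * Complex.I * ((∑ j, (k j : ℝ) * x j : ℝ) : ℂ))

/-- The Fourier coefficient `∫_{[0,1]^d} e_k(x) u(x) dx`. -/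
noncomputable def coeff {d : ℕ} (u : (Fin d → ℝ) → ℂ) (k : Fin d → ℤ) : ℂ :=
  ∫ x in cube d, e k x * u x

/-- The `F`-norm: the `ℓ¹` norm of the Fourier coefficients, with value `∞` if they are
not summable. -/
noncomputable def fNorm {d : ℕ} (u : (Fin d → ℝ) → ℂ) : ℝ≥0∞ :=
  ∑' k : Fin d → ℤ, ‖coeff u k‖ₑ

/-- The frequencies `k ∈ ℤ^d` with `|k| = ∑ⱼ |kⱼ| ≤ t`. -/
noncomputable def freq (d t : ℕ) : Finset (Fin d → ℤ) :=
  (Fintype.piFinset fun _ : Fin d => Finset.Icc (-(t : ℤ)) t).filter fun k => ∑ j, |k j| ≤ (t : ℤ)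

theorem mem_freq {d t : ℕ} {k : Fin d → ℤ} : k ∈ freq d t ↔ ∑ j, |k j| ≤ (t : ℤ) := by
  simp only [freq, Finset.mem_filter, Fintype.mem_piFinset, Finset.mem_Icc, and_iff_right_iff_imp]
  intro h j
  have h1 : |k j| ≤ ∑ i, |k i| :=
    Finset.single_le_sum (f := fun i => |k i|) (fun i _ => abs_nonneg (k i)) (Finset.mem_univ j)
  exact abs_le.mp (h1.trans h)

/-- The feature map `φ_t(x) = (e_k(x))_{|k| ≤ t}`. -/
noncomputable def feature {d : ℕ} (t : ℕ) (x : Fin d → ℝ) : freq d t → ℂ := fun k => e k.1 x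

/-- The model `g_{A,t}(x) = φ_t(x)* A φ_t(x)`. -/
noncomputable def model {d t : ℕ} (A : Matrix (freq d t) (freq d t) ℂ) (x : Fin d → ℝ) : ℂ :=
  star (feature t x) ⬝ᵥ A.mulVec (feature t x)

/-- The class `G_t` of PSD models of bandwidth `t`. -/
def psdModels (d t : ℕ) : Set ((Fin d → ℝ) → ℂ) :=
  {g | ∃ A : Matrix (freq d t) (freq d t) ℂ, A.PosSemidef ∧ g = model A}

/-- The minimizers of `f` in `[0,1]^d`. -/
def minimizers {d : ℕ} (f : (Fin d → ℝ) → ℝ) : Set (Fin d → ℝ) :=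
  {x | x ∈ cube d ∧ ∀ y ∈ cube d, f x ≤ f y}

/-- The Hessian of `f` at `x` is positive definite: `vᵀ ∇²f(x) v > 0` for all `v ≠ 0`. -/
def PosDefHessian {d : ℕ} (f : (Fin d → ℝ) → ℝ) (x : Fin d → ℝ) : Prop :=
  ∀ v : Fin d → ℝ, v ≠ 0 → 0 < iteratedFDeriv ℝ 2 f x ![v, v]

end PeriodicPSD

/-!
The argument has two halves, joined by the observation that a sum of squares of trigonometric
polynomials of degree `t` is a model of bandwidth `t`.

*Sum of squares.* With `r = ⌈m + d/2⌉`, the function `f - c` is a finite sum of squares of periodic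
`C^r` functions (`exists_sum_sq`). Near a point where `f > c` the single function `√(f - c)` will do.
Near a minimizer `z`, Hadamard's formula writes `f - c` as a quadratic form in `x - z` whose
coefficients are `C^r` functions of `x` (`contDiff_integral_segment`); in a basis orthogonal for the
Hessian at `z` its matrix is close to a positive diagonal one, so by diagonal dominance it is a
combination, with positive `C^r` coefficients, of squares of fixed linear forms
(`exists_local_sum_sq_of_posDefHessian`). This loses two derivatives. The local decompositions are
multiplied by bump functions, periodized, added up over a finite cover of the cube, and divided by
the resulting positive weight.

*Truncation.* A periodic `C^r` function `h` satisfies `∑ₖ |k|^{2r} ‖ĥₖ‖² < ∞`, so Cauchy–Schwarz on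
dyadic shells gives `∑_{|k| > t} ‖ĥₖ‖ = O(t^{d/2 - r}) = O(t^{-m})` (`exists_tail_le`). Replacing each
`h` by its truncated Fourier series changes `∑ |h|²` in `F`-norm by at most `2 ‖h‖_F` times the tail,
summed over the `h` (`exists_model_near_sum_sq`).

That the minimum is attained is a compactness argument: the trace of the Gram matrix of a model is
its zeroth Fourier coefficient (`exists_model_minimizing`).
-/

namespace PeriodicPSD

open MeasureTheory Topology Filter

variable {d : ℕ}

/-! ### Characters and the unit cube -/

theorem e_zero (x : Fin d → ℝ) : e (0 : Fin d → ℤ) x = 1 := by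
  simp [e]

theorem e_add (k l : Fin d → ℤ) (x : Fin d → ℝ) : e (k + l) x = e k x * e l x := by
  rw [e, e, e, ← Complex.exp_add]
  congr 1
  simp only [Pi.add_apply, Int.cast_add, add_mul, Finset.sum_add_distrib, Complex.ofReal_add]
  ring

theorem norm_e (k : Fin d → ℤ) (x : Fin d → ℝ) : ‖e k x‖ = 1 := by
  rw [e, Complex.norm_exp]
  simp

theorem star_e (k : Fin d → ℤ) (x : Fin d → ℝ) : star (e k x) = e (-k) x := by
  simp only [e, RCLike.star_def, ← Complex.exp_conj]
  congr 1
  simp only [map_mul, map_neg, map_ofNat, Complex.conj_I, Complex.conj_ofReal, Pi.neg_apply,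
    Int.cast_neg, neg_mul, Finset.sum_neg_distrib, Complex.ofReal_neg]
  ring

theorem contDiff_e {n : ℕ∞} (k : Fin d → ℤ) : ContDiff ℝ n (e k) := by
  unfold e
  have h : ContDiff ℝ n fun x : Fin d → ℝ => ∑ j, (k j : ℝ) * x j := by fun_prop
  exact (contDiff_const.mul (Complex.ofRealCLM.contDiff.comp h)).cexp

@[fun_prop]
theorem continuous_e (k : Fin d → ℤ) : Continuous (e k) :=
  (contDiff_e (n := 0) k).continuous

theorem isPeriodic_e (k : Fin d → ℤ) : IsPeriodic (e k) := by
  intro x l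
  simp only [e, Pi.add_apply, mul_add, Finset.sum_add_distrib, Complex.ofReal_add, Complex.exp_add]
  rw [mul_eq_left₀ (Complex.exp_ne_zero _), Complex.exp_eq_one_iff]
  refine ⟨-∑ j, k j * l j, ?_⟩
  push_cast
  ring

theorem fderiv_e_single (k : Fin d → ℤ) (x : Fin d → ℝ) (j : Fin d) :
    fderiv ℝ (e k) x (Pi.single j 1) = -(2 * Real.pi * Complex.I * k j) * e k x := by
  have h0 : HasFDerivAt (fun x : Fin d → ℝ => ∑ j, (k j : ℝ) * x j)
      (∑ j, (k j : ℝ) • ContinuousLinearMap.proj (R := ℝ) (φ := fun _ : Fin d => ℝ) j) x :=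
    HasFDerivAt.fun_sum fun j _ => (hasFDerivAt_apply j x).const_mul (k j : ℝ)
  have h : HasFDerivAt (fun x : Fin d → ℝ => ((∑ j, (k j : ℝ) * x j : ℝ) : ℂ)) _ x :=
    Complex.ofRealCLM.hasFDerivAt.comp x h0
  have h2 := ((h.const_mul (-2 * Real.pi * Complex.I)).cexp).fderiv
  have h3 : fderiv ℝ (e k) x = _ := h2
  rw [h3]
  simp only [e, smul_apply, ContinuousLinearMap.comp_apply,
    sum_apply, ContinuousLinearMap.proj_apply, smul_eq_mul,
    Complex.ofRealCLM_apply, Pi.single_apply]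
  simp
  ring

theorem isCompact_cube : IsCompact (cube d) := isCompact_Icc

theorem volume_cube : volume (cube d) = 1 := by
  simp [cube, Real.volume_Icc_pi]

theorem exists_mem_cube (x : Fin d → ℝ) :
    ∃ y ∈ cube d, ∃ k : Fin d → ℤ, x = y + fun j => (k j : ℝ) := by
  refine ⟨fun j => Int.fract (x j), ⟨fun j => Int.fract_nonneg _, fun j => (Int.fract_lt_one _).le⟩,
    fun j => ⌊x j⌋, ?_⟩
  ext j
  simp [Int.fract_add_floor]

/-! ### Transfer to the torus -/

/-- The covering map `ℝ^d → (ℝ/ℤ)^d`. -/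
def toTorus (x : Fin d → ℝ) : UnitAddTorus (Fin d) := fun j => (x j : UnitAddCircle)

theorem mFourier_toTorus (k : Fin d → ℤ) (x : Fin d → ℝ) :
    UnitAddTorus.mFourier k (toTorus x) = e (-k) x := by
  simp only [UnitAddTorus.mFourier, ContinuousMap.coe_mk, toTorus, fourier_coe_apply, e,
    ← Complex.exp_sum]
  congr 1
  push_cast
  rw [Finset.mul_sum]
  refine Finset.sum_congr rfl fun j _ => ?_
  simp
  ring

/-- A continuous periodic function descends to a continuous function on the torus. -/
theorem IsPeriodic.exists_torus {u : (Fin d → ℝ) → ℂ} (hu : IsPeriodic u) (hc : Continuous u) :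
    ∃ U : C(UnitAddTorus (Fin d), ℂ), ∀ x, U (toTorus x) = u x := by
  have hq : IsOpenQuotientMap (toTorus : (Fin d → ℝ) → UnitAddTorus (Fin d)) :=
    IsOpenQuotientMap.piMap fun _ => QuotientAddGroup.isOpenQuotientMap_mk
  have hlift : ∀ x y : Fin d → ℝ, toTorus x = toTorus y → u x = u y := by
    intro x y hxy
    have : ∀ j, ∃ n : ℤ, y j + n = x j := by
      intro j
      have h := congrFun hxy j
      simp only [toTorus] at h
      obtain ⟨n, hn⟩ := (QuotientAddGroup.eq_iff_sub_mem.mp h)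
      refine ⟨n, ?_⟩
      simp at hn
      linarith
    choose n hn using this
    rw [← hu y n]
    congr 1
    ext j
    simp [hn]
  let F : C(Fin d → ℝ, ℂ) := ⟨u, hc⟩
  let q : C(Fin d → ℝ, UnitAddTorus (Fin d)) := ⟨toTorus, hq.continuous⟩
  have hqq : Topology.IsQuotientMap q := hq.isQuotientMap
  have hfac : Function.FactorsThrough F q := fun x y h => hlift x y h
  refine ⟨hqq.lift F hfac, fun x => ?_⟩
  exact DFunLike.congr_fun (hqq.lift_comp F hfac) x

theorem mFourierCoeff_eq_coeff {u : (Fin d → ℝ) → ℂ} {U : C(UnitAddTorus (Fin d), ℂ)}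
    (h : ∀ x, U (toTorus x) = u x) (k : Fin d → ℤ) : UnitAddTorus.mFourierCoeff U k = coeff u k := by
  rw [UnitAddTorus.mFourierCoeff_eq_integral U k 0, coeff]
  have hs : {x : Fin d → ℝ | ∀ i, x i ∈ Set.Ioc ((0 : Fin d → ℝ) i) ((0 : Fin d → ℝ) i + 1)} =
      Set.univ.pi fun i => Set.Ioc ((0 : Fin d → ℝ) i) ((1 : Fin d → ℝ) i) := by
    ext x; simp
  rw [hs, cube, volume_pi, setIntegral_congr_set Measure.univ_pi_Ioc_ae_eq_Icc]
  refine integral_congr_ae (Filter.Eventually.of_forall fun x => ?_)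
  have h1 := mFourier_toTorus (-k) x
  rw [neg_neg] at h1
  simp only [smul_eq_mul]
  rw [← h1, ← h x]
  rfl

section Torus

-- `mFourierCoeff` is defined with respect to the normalised Haar measure, through instances that are
-- local to its file; they are repeated here so that `volume` has the same meaning.

noncomputable local instance instMeasureSpaceUnitAddCircle : MeasureSpace UnitAddCircle :=
  ⟨AddCircle.haarAddCircle⟩

local instance instIsAddHaarMeasureUnitAddCircle :
    Measure.IsAddHaarMeasure (volume : Measure UnitAddCircle) :=
  inferInstanceAs (Measure.IsAddHaarMeasure AddCircle.haarAddCircle)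

local instance instIsProbabilityMeasureUnitAddCircle :
    IsProbabilityMeasure (volume : Measure UnitAddCircle) :=
  inferInstanceAs (IsProbabilityMeasure AddCircle.haarAddCircle)

/-- Bessel's inequality, in qualitative form. -/
theorem IsPeriodic.summable_sq_coeff {u : (Fin d → ℝ) → ℂ} (hu : IsPeriodic u)
    (hc : Continuous u) : Summable fun k => ‖coeff u k‖ ^ 2 := by
  obtain ⟨U, hU⟩ := hu.exists_torus hc
  have h := (UnitAddTorus.hasSum_sq_mFourierCoeff (ContinuousMap.toLp (E := ℂ) 2 volume ℂ U)).summable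
  simpa only [UnitAddTorus.mFourierCoeff_toLp, mFourierCoeff_eq_coeff hU] using h

end Torus

/-- Pointwise Fourier inversion; the sign is due to `e k` carrying `exp (-2πi ⬝)`. -/
theorem IsPeriodic.hasSum_coeff {u : (Fin d → ℝ) → ℂ} (hu : IsPeriodic u)
    (hc : Continuous u) (hs : Summable fun k => ‖coeff u k‖) (x : Fin d → ℝ) :
    HasSum (fun k => coeff u k * e (-k) x) (u x) := by
  obtain ⟨U, hU⟩ := hu.exists_torus hc
  have hs' : Summable (UnitAddTorus.mFourierCoeff U) := by
    refine Summable.of_norm ?_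
    simpa only [mFourierCoeff_eq_coeff hU] using hs
  have h := UnitAddTorus.hasSum_mFourier_series_apply_of_summable hs' (toTorus x)
  simpa only [mFourierCoeff_eq_coeff hU, hU, mFourier_toTorus, smul_eq_mul] using h

/-! ### Derivatives and Fourier coefficients -/

/-- By the divergence theorem: the contributions of opposite faces of the cube cancel. -/
theorem IsPeriodic.integral_fderiv_single {u : (Fin d → ℝ) → ℂ} (hu : IsPeriodic u)
    (hc : ContDiff ℝ 1 u) (j : Fin d) :
    ∫ x in cube d, fderiv ℝ u x (Pi.single j 1) = 0 := by
  obtain _ | n := d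
  · exact j.elim0
  have hcont : Continuous fun x => fderiv ℝ u x (Pi.single j 1) :=
    (hc.continuous_fderiv one_ne_zero).clm_apply continuous_const
  have hsum : ∀ x, ∑ i : Fin (n + 1), (if i = j then fderiv ℝ u x else 0) (Pi.single i 1) =
      fderiv ℝ u x (Pi.single j 1) := by
    intro x
    rw [Finset.sum_eq_single j (fun i _ hi => by simp [hi]) (by simp)]
    simp
  have h := integral_divergence_of_hasFDerivAt_off_countable' (E := ℂ) (0 : Fin (n + 1) → ℝ) 1
    zero_le_one (fun i x => if i = j then u x else 0)
    (fun i x => if i = j then fderiv ℝ u x else 0) ∅ Set.countable_empty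
    (fun i => by
      by_cases hi : i = j
      · simpa [hi] using hc.continuous.continuousOn
      · simpa [hi] using continuousOn_const)
    (fun x _ i => by
      by_cases hi : i = j
      · simpa [hi] using (hc.differentiable one_ne_zero x).hasFDerivAt
      · simpa [hi] using hasFDerivAt_const (0 : ℂ) x)
    (by
      simp only [hsum]
      exact hcont.continuousOn.integrableOn_compact isCompact_cube)
  simp only [hsum] at h
  rw [cube, h]
  refine Finset.sum_eq_zero fun i _ => ?_
  by_cases hi : i = j
  · simp only [hi, if_true]
    rw [sub_eq_zero]
    refine integral_congr_ae (Filter.Eventually.of_forall fun y => ?_)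
    have h2 := hu (Fin.insertNth j (0 : ℝ) y) (Pi.single j 1)
    simp only [Pi.one_apply, Pi.zero_apply]
    rw [← h2]
    congr 1
    ext i
    refine Fin.succAboveCases j ?_ (fun i' => ?_) i <;> simp
  · simp [hi]

theorem coeff_fderiv_single {u : (Fin d → ℝ) → ℂ} (hu : IsPeriodic u)
    (hc : ContDiff ℝ 1 u) (j : Fin d) (k : Fin d → ℤ) :
    coeff (fun x => fderiv ℝ u x (Pi.single j 1)) k =
      2 * Real.pi * Complex.I * k j * coeff u k := by
  have hp : IsPeriodic fun x => e k x * u x := fun x l => by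
    simp only [isPeriodic_e k x l, hu x l]
  have he := contDiff_e (n := 1) k
  have h := hp.integral_fderiv_single (he.mul hc) j
  have hd : ∀ x, fderiv ℝ (fun x => e k x * u x) x (Pi.single j 1) =
      e k x * fderiv ℝ u x (Pi.single j 1) -
        2 * Real.pi * Complex.I * k j * (e k x * u x) := by
    intro x
    have h2 := ((he.differentiable one_ne_zero x).hasFDerivAt.mul
      (hc.differentiable one_ne_zero x).hasFDerivAt).fderiv
    have h3 : fderiv ℝ (fun x => e k x * u x) x = _ := h2
    rw [h3]
    simp only [add_apply, smul_apply, smul_eq_mul,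
      fderiv_e_single]
    ring
  simp only [hd] at h
  have hcont : Continuous fun x => fderiv ℝ u x (Pi.single j 1) :=
    (hc.continuous_fderiv one_ne_zero).clm_apply continuous_const
  have hcu := hc.continuous
  rw [integral_sub, integral_const_mul, sub_eq_zero] at h
  · exact h
  · exact ((continuous_e k).mul hcont).continuousOn.integrableOn_compact isCompact_cube
  · exact (continuous_const.mul ((continuous_e k).mul hcu)).continuousOn.integrableOn_compact
      isCompact_cube

theorem integral_e (k : Fin d → ℤ) : ∫ x in cube d, e k x = if k = 0 then 1 else 0 := by
  split_ifs with h
  · subst h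
    simp [e_zero, Measure.real, volume_cube]
  · obtain ⟨j, hj⟩ := Function.ne_iff.mp h
    have h1 := (isPeriodic_e k).integral_fderiv_single (contDiff_e k) j
    simp only [fderiv_e_single] at h1
    rw [integral_const_mul] at h1
    refine (mul_eq_zero.mp h1).resolve_left ?_
    simpa [Real.pi_ne_zero] using hj

theorem IsPeriodic.fderiv_single {u : (Fin d → ℝ) → ℂ} (hu : IsPeriodic u) (v : Fin d → ℝ) :
    IsPeriodic fun x => fderiv ℝ u x v := by
  intro x k
  have : (fun y => u (y + fun j => (k j : ℝ))) = u := funext fun y => hu y k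
  have h := fderiv_comp_add_right (𝕜 := ℝ) (f := u) (x := x) (fun j => (k j : ℝ))
  rw [this] at h
  simp only [h]

theorem IsPeriodic.summable_sq_pow_mul_coeff (j : Fin d) (r : ℕ) :
    ∀ {u : (Fin d → ℝ) → ℂ}, IsPeriodic u → ContDiff ℝ r u →
      Summable fun k : Fin d → ℤ => (|(k j : ℝ)| ^ r * ‖coeff u k‖) ^ 2 := by
  induction r with
  | zero =>
    intro u hu hc
    simpa using hu.summable_sq_coeff hc.continuous
  | succ r ih =>
    intro u hu hc
    have hd : ContDiff ℝ r fun x => fderiv ℝ u x (Pi.single j 1) :=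
      (hc.fderiv_right (m := r) (by norm_cast)).clm_apply contDiff_const
    have h := ih (hu.fderiv_single (Pi.single j 1)) hd
    have hc1 : ContDiff ℝ 1 u := hc.of_le (by norm_cast; omega)
    refine (h.mul_left ((2 * Real.pi)⁻¹ ^ 2)).congr fun k => ?_
    rw [coeff_fderiv_single hu hc1, ← mul_pow]
    congr 1
    simp only [norm_mul, Complex.norm_I, Complex.norm_real, Complex.norm_intCast, Complex.norm_ofNat,
      Real.norm_eq_abs, abs_of_pos Real.pi_pos]
    have := Real.pi_ne_zero
    rw [pow_succ]
    field_simp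

/-! ### Truncation error of a Fourier series -/

theorem card_freq_le (d t : ℕ) : (freq d t).card ≤ (2 * t + 1) ^ d := by
  refine (Finset.card_filter_le _ _).trans (le_of_eq ?_)
  rw [Fintype.card_piFinset]
  simp only [Int.card_Icc, Finset.prod_const, Finset.card_univ, Fintype.card_fin]
  congr 1
  omega

theorem IsPeriodic.summable_sq_norm_pow_mul_coeff {r : ℕ} {u : (Fin d → ℝ) → ℂ}
    (hu : IsPeriodic u) (hc : ContDiff ℝ r u) :
    Summable fun k : Fin d → ℤ => (((∑ j, |k j| : ℤ) : ℝ) ^ r * ‖coeff u k‖) ^ 2 := by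
  obtain _ | n := r
  · simpa using hu.summable_sq_coeff hc.continuous
  have h : Summable fun k : Fin d → ℤ =>
      (d : ℝ) ^ (2 * n + 1) * ∑ j, (|(k j : ℝ)| ^ (n + 1) * ‖coeff u k‖) ^ 2 :=
    (summable_sum fun j _ => hu.summable_sq_pow_mul_coeff j (n + 1) hc).mul_left _
  refine h.of_nonneg_of_le (fun k => sq_nonneg _) fun k => ?_
  have h1 : (∑ j, |(k j : ℝ)|) ^ (2 * n + 2) ≤
      (d : ℝ) ^ (2 * n + 1) * ∑ j, |(k j : ℝ)| ^ (2 * n + 2) := by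
    obtain rfl | hd := Nat.eq_zero_or_pos d
    · simp
    have h2 := pow_sum_div_card_le_sum_pow (s := Finset.univ) (f := fun j => |(k j : ℝ)|)
      (fun j _ => abs_nonneg _) (2 * n + 1)
    rw [div_le_iff₀ (by simp [hd]), mul_comm] at h2
    simpa [mul_comm] using h2
  push_cast
  simp only [mul_pow, ← pow_mul, ← Finset.sum_mul, ← mul_assoc]
  rw [show (n + 1) * 2 = 2 * n + 2 by ring]
  gcongr

/-- Cauchy–Schwarz on the dyadic shell `T < |k| ≤ 2T`. -/
theorem sum_shell_le {m : ℝ} {r : ℕ} (hr : m + (d : ℝ) / 2 ≤ r)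
    {a : (Fin d → ℤ) → ℝ}
    (hs : Summable fun k => (((∑ j, |k j| : ℤ) : ℝ) ^ r * a k) ^ 2) {T : ℕ} (hT : 1 ≤ T) :
    ∑ k ∈ freq d (2 * T) \ freq d T, a k ≤
      √(5 ^ d * ∑' k, (((∑ j, |k j| : ℤ) : ℝ) ^ r * a k) ^ 2) * (T : ℝ) ^ (-m) := by
  set M := ∑' k, (((∑ j, |k j| : ℤ) : ℝ) ^ r * a k) ^ 2 with hM
  have hM0 : 0 ≤ M := tsum_nonneg fun k => sq_nonneg _
  have hT1 : (1 : ℝ) ≤ T := by exact_mod_cast hT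
  have hT0 : (0 : ℝ) < T := by linarith
  set B := freq d (2 * T) \ freq d T with hB
  have hcard : (B.card : ℝ) ≤ (5 * T : ℝ) ^ d := by
    have h1 : B.card ≤ (5 * T) ^ d :=
      (Finset.card_le_card Finset.sdiff_subset).trans
        ((card_freq_le d (2 * T)).trans (Nat.pow_le_pow_left (by omega) d))
    exact_mod_cast h1
  have hsq : ∑ k ∈ B, a k ^ 2 ≤ (T : ℝ) ^ (-(2 * r : ℝ)) * M := by
    have h1 : ∀ k ∈ B, a k ^ 2 ≤
        (T : ℝ) ^ (-(2 * r : ℝ)) * (((∑ j, |k j| : ℤ) : ℝ) ^ r * a k) ^ 2 := by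
      intro k hk
      have h2 : (T : ℝ) ≤ ((∑ j, |k j| : ℤ) : ℝ) := by
        have := (Finset.mem_sdiff.mp hk).2
        rw [mem_freq, not_le] at this
        exact_mod_cast this.le
      rw [Real.rpow_neg hT0.le, ← div_eq_inv_mul, le_div_iff₀ (by positivity)]
      have h3 : (T : ℝ) ^ (2 * r : ℝ) = ((T : ℝ) ^ r) ^ 2 := by
        rw [← pow_mul, ← Real.rpow_natCast]
        congr 1
        push_cast
        ring
      rw [h3, mul_pow, mul_comm]
      gcongr
    refine (Finset.sum_le_sum h1).trans ?_
    rw [← Finset.mul_sum]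
    gcongr
    exact hs.sum_le_tsum _ fun k _ => sq_nonneg _
  refine le_of_sq_le_sq ?_ (by positivity)
  calc (∑ k ∈ B, a k) ^ 2 ≤ B.card * ∑ k ∈ B, a k ^ 2 := sq_sum_le_card_mul_sum_sq
    _ ≤ (5 * T : ℝ) ^ d * ((T : ℝ) ^ (-(2 * r : ℝ)) * M) := by
        gcongr
    _ = 5 ^ d * M * (T : ℝ) ^ (d - 2 * r : ℝ) := by
        rw [sub_eq_add_neg, Real.rpow_add hT0, Real.rpow_natCast]
        ring
    _ ≤ 5 ^ d * M * (T : ℝ) ^ (-m * 2) := by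
        gcongr
        linarith
    _ = (√(5 ^ d * M) * (T : ℝ) ^ (-m)) ^ 2 := by
        rw [mul_pow, Real.sq_sqrt (by positivity), Real.rpow_mul hT0.le, Real.rpow_two]

/-- If `∑ₖ |k|^{2r} ‖aₖ‖²` converges and `r ≥ m + d/2`, then the `ℓ¹` tails of `a` decay like
`t^{-m}`. The shells are dyadic, so that the bounds on them form a geometric series and no
logarithm or epsilon is lost. -/
theorem exists_tail_le {m : ℝ} (hm : 0 < m) {r : ℕ} (hr : m + (d : ℝ) / 2 ≤ r)
    {a : (Fin d → ℤ) → ℂ}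
    (hs : Summable fun k => (((∑ j, |k j| : ℤ) : ℝ) ^ r * ‖a k‖) ^ 2) :
    ∃ C : ℝ, 0 ≤ C ∧ ∀ t : ℕ, 1 ≤ t →
      ∑' k, (if k ∈ freq d t then 0 else ‖a k‖ₑ) ≤ ENNReal.ofReal (C * (t : ℝ) ^ (-m)) := by
  set K := √(5 ^ d * ∑' k, (((∑ j, |k j| : ℤ) : ℝ) ^ r * ‖a k‖) ^ 2)
  set q : ℝ := 2 ^ (-m) with hq
  have hq0 : 0 < q := by positivity
  have hq1 : q < 1 := Real.rpow_lt_one_of_one_lt_of_neg one_lt_two (by linarith)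
  refine ⟨K * (1 - q)⁻¹, mul_nonneg (Real.sqrt_nonneg _) (inv_nonneg.mpr (by linarith)),
    fun t ht => ?_⟩
  have hpt : ∀ k : Fin d → ℤ, (if k ∈ freq d t then 0 else ‖a k‖ₑ) ≤
      ∑' j : ℕ, if k ∈ freq d (2 * (2 ^ j * t)) \ freq d (2 ^ j * t) then ‖a k‖ₑ else 0 := by
    intro k
    split_ifs with hk
    · exact zero_le
    -- `k` lies in the shell that ends at the first dyadic multiple of `t` bounding `|k|`.
    have hex : ∃ j : ℕ, k ∈ freq d (2 ^ j * t) := by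
      obtain ⟨j, hj⟩ := pow_unbounded_of_one_lt (∑ i, |k i|).toNat one_lt_two
      refine ⟨j, mem_freq.mpr ?_⟩
      have h1 : ∑ i, |k i| ≤ ((2 ^ j : ℕ) : ℤ) := by omega
      have h2 : 2 ^ j ≤ 2 ^ j * t := Nat.le_mul_of_pos_right _ ht
      exact h1.trans (by exact_mod_cast h2)
    classical
    obtain ⟨j, hj⟩ : ∃ j, Nat.find hex = j + 1 := by
      refine Nat.exists_eq_succ_of_ne_zero fun h0 => hk ?_
      have := Nat.find_spec hex
      rw [h0] at this
      simpa using this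
    have h1 := Nat.find_spec hex
    rw [hj, pow_succ', mul_assoc] at h1
    have h2 : k ∉ freq d (2 ^ j * t) := Nat.find_min hex (by omega)
    refine le_trans (le_of_eq ?_) (ENNReal.le_tsum j)
    rw [if_pos (Finset.mem_sdiff.mpr ⟨h1, h2⟩)]
  refine (ENNReal.tsum_le_tsum hpt).trans ?_
  rw [ENNReal.tsum_comm]
  have hblock : ∀ j : ℕ, (∑' k : Fin d → ℤ,
      if k ∈ freq d (2 * (2 ^ j * t)) \ freq d (2 ^ j * t) then ‖a k‖ₑ else 0) ≤
      ENNReal.ofReal (K * (t : ℝ) ^ (-m) * q ^ j) := by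
    intro j
    have hT : 1 ≤ 2 ^ j * t := Nat.one_le_iff_ne_zero.mpr (by positivity)
    rw [tsum_eq_sum (s := freq d (2 * (2 ^ j * t)) \ freq d (2 ^ j * t))
      (fun k hk => if_neg hk), Finset.sum_congr rfl (fun k hk => if_pos hk)]
    simp only [← ofReal_norm]
    rw [← ENNReal.ofReal_sum_of_nonneg fun k _ => norm_nonneg _]
    refine ENNReal.ofReal_le_ofReal ((sum_shell_le hr hs hT).trans (le_of_eq ?_))
    have h1 : ((2 ^ j * t : ℕ) : ℝ) ^ (-m) = q ^ j * (t : ℝ) ^ (-m) := by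
      push_cast
      rw [Real.mul_rpow (by positivity) (by positivity), ← Real.rpow_natCast, ← Real.rpow_natCast,
        hq, ← Real.rpow_mul zero_le_two, ← Real.rpow_mul zero_le_two, mul_comm (j : ℝ)]
    rw [h1]
    ring
  refine (ENNReal.tsum_le_tsum hblock).trans ?_
  rw [← ENNReal.ofReal_tsum_of_nonneg (fun j => by positivity)
    ((summable_geometric_of_lt_one hq0.le hq1).mul_left _), tsum_mul_left,
    tsum_geometric_of_lt_one hq0.le hq1]
  exact ENNReal.ofReal_le_ofReal (le_of_eq (by ring))

theorem tsum_enorm_ne_top {m : ℝ} (hm : 0 < m) {r : ℕ} (hr : m + (d : ℝ) / 2 ≤ r)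
    {a : (Fin d → ℤ) → ℂ}
    (hs : Summable fun k => (((∑ j, |k j| : ℤ) : ℝ) ^ r * ‖a k‖) ^ 2) : ∑' k, ‖a k‖ₑ ≠ ∞ := by
  obtain ⟨C, -, hC⟩ := exists_tail_le hm hr hs
  have h : ∀ k, ‖a k‖ₑ = (if k ∈ freq d 1 then ‖a k‖ₑ else 0) +
      (if k ∈ freq d 1 then 0 else ‖a k‖ₑ) := fun k => by split_ifs <;> simp
  rw [tsum_congr h, ENNReal.tsum_add, ENNReal.add_ne_top]
  refine ⟨?_, ne_top_of_le_ne_top ENNReal.ofReal_ne_top (hC 1 le_rfl)⟩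
  rw [tsum_eq_sum (s := freq d 1) (fun k hk => if_neg hk)]
  refine (ENNReal.sum_lt_top.mpr fun k _ => ?_).ne
  split_ifs
  exact enorm_lt_top

/-! ### Absolutely convergent trigonometric series -/

theorem coeff_e (k n : Fin d → ℤ) : coeff (e k) n = if n = -k then 1 else 0 := by
  simp only [coeff, ← e_add, integral_e, add_eq_zero_iff_eq_neg]

theorem hasSum_coeff_of_hasSum {ι : Type*} [Countable ι] {c : ι → ℂ} {κ : ι → Fin d → ℤ}
    (hc : Summable fun i => ‖c i‖) {u : (Fin d → ℝ) → ℂ}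
    (hu : ∀ x, HasSum (fun i => c i * e (κ i) x) (u x)) (n : Fin d → ℤ) :
    HasSum (fun i => if n = -κ i then c i else 0) (coeff u n) := by
  have hint : ∀ i, IntegrableOn (fun x => e n x * (c i * e (κ i) x)) (cube d) := fun i =>
    (Continuous.continuousOn (by fun_prop)).integrableOn_compact isCompact_cube
  have hnorm : ∀ i, ∫ x in cube d, ‖e n x * (c i * e (κ i) x)‖ = ‖c i‖ := by
    intro i
    simp only [norm_mul, norm_e, one_mul, mul_one]
    simp [Measure.real, volume_cube]
  have h := hasSum_integral_of_summable_integral_norm (μ := volume.restrict (cube d)) hint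
    (by simpa only [hnorm] using hc)
  have h1 : ∀ i, ∫ x in cube d, e n x * (c i * e (κ i) x) = if n = -κ i then c i else 0 := by
    intro i
    have h2 := coeff_e (κ i) n
    rw [coeff] at h2
    simp only [mul_left_comm (e n _)]
    rw [integral_const_mul, h2]
    split_ifs <;> simp
  have h3 : ∫ x in cube d, ∑' i, e n x * (c i * e (κ i) x) = coeff u n := by
    simp only [((hu _).mul_left _).tsum_eq]
    rfl
  rw [← h3]
  simpa only [h1] using h

/-- The `F`-norm of an absolutely convergent trigonometric series is at most the sum of the
moduli of its coefficients, even if frequencies are repeated. -/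
theorem fNorm_le_of_hasSum {ι : Type*} [Countable ι] {c : ι → ℂ} {κ : ι → Fin d → ℤ}
    (hc : Summable fun i => ‖c i‖) {u : (Fin d → ℝ) → ℂ}
    (hu : ∀ x, HasSum (fun i => c i * e (κ i) x) (u x)) : fNorm u ≤ ∑' i, ‖c i‖ₑ := by
  have h1 : ∀ n, ‖coeff u n‖ₑ ≤ ∑' i, if n = -κ i then ‖c i‖ₑ else 0 := by
    intro n
    rw [← (hasSum_coeff_of_hasSum hc hu n).tsum_eq]
    refine enorm_tsum_le_tsum_enorm.trans (le_of_eq (tsum_congr fun i => ?_))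
    split_ifs <;> simp
  refine (ENNReal.tsum_le_tsum h1).trans ?_
  rw [ENNReal.tsum_comm]
  simp only [tsum_ite_eq, le_refl]

/-! ### Models of bandwidth `t` -/

theorem model_apply {t : ℕ} (A : Matrix (freq d t) (freq d t) ℂ) (x : Fin d → ℝ) :
    model A x = ∑ p, ∑ q, A p q * e (q.1 - p.1) x := by
  simp only [model, dotProduct, Matrix.mulVec, feature, Pi.star_apply, star_e, Finset.mul_sum,
    sub_eq_add_neg, e_add]
  exact Finset.sum_congr rfl fun p _ => Finset.sum_congr rfl fun q _ => by ring

theorem summable_enorm_iff {ι : Type*} {a : ι → ℂ} :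
    ∑' i, ‖a i‖ₑ ≠ ∞ ↔ Summable fun i => ‖a i‖ := by
  rw [← summable_norm_iff (f := fun i => ‖a i‖)]
  simp only [enorm_eq_nnnorm, norm_norm]
  rw [ENNReal.tsum_coe_ne_top_iff_summable]
  exact NNReal.summable_coe.symm

theorem hasSum_mul_star {ι : Type*} {f : ι → ℂ} {s : ℂ} (hf : Summable fun i => ‖f i‖)
    (hs : HasSum f s) : HasSum (fun p : ι × ι => f p.1 * star (f p.2)) (s * star s) := by
  have h : Summable fun i => ‖star (f i)‖ := by simpa only [norm_star] using hf
  exact HasSum.mul (g := fun i => star (f i)) hs hs.star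
    (summable_mul_of_summable_norm (g := fun i => star (f i)) hf h)

/-- Truncating the Fourier series of each `hᵢ` to the frequencies of `freq d t` turns
`∑ᵢ |hᵢ|²` into a model of bandwidth `t`; the error in `F`-norm is controlled by the `ℓ¹` tails
of the Fourier series. -/
theorem exists_model_near_sum_sq {ι : Type*} [Fintype ι] {a : ι → (Fin d → ℤ) → ℂ}
    (ha : ∀ i, ∑' k, ‖a i k‖ₑ ≠ ∞) {h : ι → (Fin d → ℝ) → ℂ}
    (hh : ∀ i x, HasSum (fun k => a i k * e (-k) x) (h i x)) (t : ℕ) :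
    ∃ g ∈ psdModels d t, fNorm (fun x => ∑ i, h i x * star (h i x) - g x) ≤
      ∑ i, 2 * (∑' k, ‖a i k‖ₑ) * ∑' k, (if k ∈ freq d t then 0 else ‖a i k‖ₑ) := by
  classical
  set A : Matrix (freq d t) (freq d t) ℂ :=
    ∑ i, Matrix.vecMulVec (fun p : freq d t => a i p.1) (star fun p : freq d t => a i p.1) with hA
  have hApsd : A.PosSemidef :=
    Matrix.posSemidef_sum _ fun i _ => Matrix.posSemidef_vecMulVec_self_star _
  have hApq : ∀ p q, A p q = ∑ i, a i p.1 * star (a i q.1) := by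
    intro p q
    simp [hA, Matrix.sum_apply, Matrix.vecMulVec_apply]
  refine ⟨model A, ⟨A, hApsd, rfl⟩, ?_⟩
  have hsum : ∀ i, Summable fun k => ‖a i k‖ := fun i => summable_enorm_iff.mp (ha i)
  set S := freq d t ×ˢ freq d t
  set F : (Fin d → ℤ) × (Fin d → ℤ) → ℂ := fun p => ∑ i, a i p.1 * star (a i p.2) with hF
  have hFsum : Summable fun p => ‖F p‖ := by
    refine Summable.of_nonneg_of_le (fun p => norm_nonneg _)
      (fun p => norm_sum_le Finset.univ _) (summable_sum fun i _ => ?_)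
    simp only [norm_mul, norm_star]
    exact (hsum i).mul_of_nonneg (hsum i) (fun _ => norm_nonneg _) fun _ => norm_nonneg _
  have hfull : ∀ x, HasSum (fun p : (Fin d → ℤ) × (Fin d → ℤ) => F p * e (p.2 - p.1) x)
      (∑ i, h i x * star (h i x)) := by
    intro x
    have h1 : ∀ i, HasSum (fun p : (Fin d → ℤ) × (Fin d → ℤ) =>
        a i p.1 * e (-p.1) x * star (a i p.2 * e (-p.2) x)) (h i x * star (h i x)) := by
      intro i
      have h2 : Summable fun k => ‖a i k * e (-k) x‖ := by
        simpa only [norm_mul, norm_e, mul_one] using hsum i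
      have h3 := hasSum_mul_star h2 (hh i x)
      exact h3
    have h2 : HasSum (fun p : (Fin d → ℤ) × (Fin d → ℤ) => ∑ i,
        a i p.1 * e (-p.1) x * star (a i p.2 * e (-p.2) x)) (∑ i, h i x * star (h i x)) :=
      hasSum_sum fun i _ => h1 i
    refine h2.congr_fun fun p => ?_
    rw [hF, Finset.sum_mul]
    refine Finset.sum_congr rfl fun i _ => ?_
    rw [star_mul', star_e, neg_neg, sub_eq_add_neg, e_add]
    ring
  have hpart : ∀ x, HasSum (fun p : (Fin d → ℤ) × (Fin d → ℤ) =>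
      if p ∈ S then F p * e (p.2 - p.1) x else 0) (model A x) := by
    intro x
    have h1 : model A x = ∑ p ∈ S, if p ∈ S then F p * e (p.2 - p.1) x else 0 := by
      rw [Finset.sum_congr rfl fun p hp => if_pos hp, Finset.sum_product, model_apply,
        ← Finset.sum_coe_sort (freq d t)]
      refine Finset.sum_congr rfl fun p _ => ?_
      rw [← Finset.sum_coe_sort (freq d t)]
      exact Finset.sum_congr rfl fun q _ => by rw [hApq]
    rw [h1]
    exact hasSum_sum_of_ne_finset_zero fun p hp => if_neg hp
  have hdiff : ∀ x, HasSum (fun p : (Fin d → ℤ) × (Fin d → ℤ) =>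
      (if p ∈ S then 0 else F p) * e (p.2 - p.1) x) (∑ i, h i x * star (h i x) - model A x) := by
    intro x
    refine ((hfull x).sub (hpart x)).congr_fun fun p => ?_
    split_ifs <;> simp
  refine (fNorm_le_of_hasSum (hFsum.of_nonneg_of_le (fun _ => norm_nonneg _) fun p => ?_)
    hdiff).trans ?_
  · split_ifs <;> simp
  have hpt : ∀ p : (Fin d → ℤ) × (Fin d → ℤ), ‖if p ∈ S then 0 else F p‖ₑ ≤
      ∑ i, ((if p.1 ∈ freq d t then 0 else ‖a i p.1‖ₑ) * ‖a i p.2‖ₑ +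
        ‖a i p.1‖ₑ * if p.2 ∈ freq d t then 0 else ‖a i p.2‖ₑ) := by
    intro p
    by_cases hp : p ∈ S
    · simp [hp]
    rw [if_neg hp]
    refine (enorm_sum_le Finset.univ _).trans (Finset.sum_le_sum fun i _ => ?_)
    rw [enorm_mul, show ‖star (a i p.2)‖ₑ = ‖a i p.2‖ₑ by simp [enorm_eq_nnnorm]]
    by_cases h1 : p.1 ∈ freq d t
    · have h2 : p.2 ∉ freq d t := fun h2 => hp (Finset.mem_product.mpr ⟨h1, h2⟩)
      simp [h1, h2]
    · simp [h1]
  refine (ENNReal.tsum_le_tsum hpt).trans ?_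
  rw [Summable.tsum_finsetSum fun _ _ => ENNReal.summable]
  refine Finset.sum_le_sum fun i _ => ?_
  rw [ENNReal.tsum_add, ENNReal.tsum_prod', ENNReal.tsum_prod']
  simp only [ENNReal.tsum_mul_left, ENNReal.tsum_mul_right]
  exact le_of_eq (by ring)

/-! ### The minimum is attained -/

theorem coeff_model {t : ℕ} (A : Matrix (freq d t) (freq d t) ℂ) (n : Fin d → ℤ) :
    coeff (model A) n = ∑ p, ∑ q, if n = -(q.1 - p.1) then A p q else 0 := by
  have h := hasSum_coeff_of_hasSum (ι := freq d t × freq d t) (c := fun p => A p.1 p.2)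
    (κ := fun p => p.2.1 - p.1.1) (Summable.of_finite) (u := model A) (fun x => by
      rw [model_apply, ← Fintype.sum_prod_type']
      exact hasSum_fintype _) n
  rw [← Fintype.sum_prod_type']
  exact h.unique (hasSum_fintype _)

theorem coeff_model_zero {t : ℕ} (A : Matrix (freq d t) (freq d t) ℂ) :
    coeff (model A) 0 = A.trace := by
  simp only [coeff_model, Matrix.trace, Matrix.diag]
  refine Finset.sum_congr rfl fun p _ => ?_
  rw [Finset.sum_eq_single p]
  · simp
  · intro q _ hq
    rw [if_neg]
    intro h
    rw [eq_comm, neg_eq_zero, sub_eq_zero] at h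
    exact hq (Subtype.ext h)
  · simp

theorem continuous_model {t : ℕ} (A : Matrix (freq d t) (freq d t) ℂ) : Continuous (model A) := by
  have : model A = fun x => ∑ p, ∑ q, A p q * e (q.1 - p.1) x := funext (model_apply A)
  rw [this]
  fun_prop

theorem coeff_sub {u v : (Fin d → ℝ) → ℂ} (hu : Continuous u) (hv : Continuous v)
    (n : Fin d → ℤ) : coeff (fun x => u x - v x) n = coeff u n - coeff v n := by
  simp only [coeff, mul_sub]
  exact integral_sub ((Continuous.continuousOn (by fun_prop)).integrableOn_compact isCompact_cube)
    ((Continuous.continuousOn (by fun_prop)).integrableOn_compact isCompact_cube)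

open scoped MatrixOrder Matrix.Norms.L2Operator in
theorem _root_.Matrix.PosSemidef.exists_eq_conjTranspose_mul_self {n : Type*} [Fintype n]
    {A : Matrix n n ℂ} (hA : A.PosSemidef) : ∃ B : Matrix n n ℂ, A = B.conjTranspose * B := by
  classical
  exact CStarAlgebra.nonneg_iff_eq_star_mul_self.mp hA.nonneg

/-- The distance to the class of models of bandwidth `t` is attained. Writing the Gram matrix as
`BᴴB`, its trace `∑ |Bᵢⱼ|²` is the zeroth Fourier coefficient of the model, so a bound on the
distance confines `B` to a compact set, on which the `F`-norm is lower semicontinuous. -/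
theorem exists_model_minimizing {u : (Fin d → ℝ) → ℂ} (hu : Continuous u) (t : ℕ) :
    ∃ g ∈ psdModels d t, ∀ g' ∈ psdModels d t,
      fNorm (fun x => u x - g x) ≤ fNorm (fun x => u x - g' x) := by
  classical
  let ψ : (freq d t → freq d t → ℂ) → Matrix (freq d t) (freq d t) ℂ := fun B =>
    (Matrix.of B).conjTranspose * Matrix.of B
  let Φ : (freq d t → freq d t → ℂ) → ℝ≥0∞ := fun B => fNorm fun x => u x - model (ψ B) x
  have hψ : ∀ B, model (ψ B) ∈ psdModels d t := fun B =>
    ⟨_, Matrix.posSemidef_conjTranspose_mul_self _, rfl⟩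
  have hψ' : ∀ g ∈ psdModels d t, ∃ B, g = model (ψ B) := by
    rintro g ⟨A, hA, rfl⟩
    obtain ⟨B, hB⟩ := hA.exists_eq_conjTranspose_mul_self
    exact ⟨B, by rw [hB]; rfl⟩
  suffices h : ∃ B, ∀ B', Φ B ≤ Φ B' by
    obtain ⟨B, hB⟩ := h
    refine ⟨_, hψ B, fun g' hg' => ?_⟩
    obtain ⟨B', rfl⟩ := hψ' g' hg'
    exact hB B'
  by_cases htop : ∃ B, Φ B ≠ ∞
  swap
  · push Not at htop
    exact ⟨0, fun B' => by rw [htop B']; exact le_top⟩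
  obtain ⟨B₀, hB₀⟩ := htop
  have hlsc : LowerSemicontinuous Φ := by
    refine lowerSemicontinuous_tsum fun n => Continuous.lowerSemicontinuous ?_
    simp only [coeff_sub hu (continuous_model _), coeff_model]
    refine Continuous.enorm (continuous_const.sub ?_)
    refine continuous_finsetSum _ fun p _ => continuous_finsetSum _ fun q _ => ?_
    split_ifs
    · simp only [ψ, Matrix.mul_apply, Matrix.conjTranspose_apply, Matrix.of_apply]
      fun_prop
    · exact continuous_const
  set R : ℝ := ‖coeff u 0‖ + (Φ B₀).toReal with hR
  have hR0 : 0 ≤ R := by positivity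
  have hbound : ∀ B, Φ B ≤ Φ B₀ → ∀ p q, ‖B p q‖ ≤ √R := by
    intro B hB p q
    refine Real.le_sqrt_of_sq_le ?_
    have htr : (ψ B).trace = ((∑ p, ∑ q, ‖B q p‖ ^ 2 : ℝ) : ℂ) := by
      simp only [ψ, Matrix.trace, Matrix.diag, Matrix.mul_apply, Matrix.conjTranspose_apply,
        Matrix.of_apply]
      push_cast
      refine Finset.sum_congr rfl fun p _ => Finset.sum_congr rfl fun q _ => ?_
      exact Complex.conj_mul' _
    have h1 : ‖B p q‖ ^ 2 ≤ ∑ p, ∑ q, ‖B q p‖ ^ 2 :=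
      (Finset.single_le_sum (f := fun p => ‖B p q‖ ^ 2) (fun _ _ => sq_nonneg _)
        (Finset.mem_univ p)).trans
        (Finset.single_le_sum (f := fun q => ∑ p, ‖B p q‖ ^ 2)
          (fun _ _ => Finset.sum_nonneg fun _ _ => sq_nonneg _) (Finset.mem_univ q))
    have h2 : ‖(ψ B).trace‖ = ∑ p, ∑ q, ‖B q p‖ ^ 2 := by
      rw [htr, Complex.norm_real, Real.norm_of_nonneg]
      exact Finset.sum_nonneg fun _ _ => Finset.sum_nonneg fun _ _ => sq_nonneg _
    have h3 : ‖coeff u 0 - (ψ B).trace‖ ≤ (Φ B₀).toReal := by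
      rw [← coeff_model_zero, ← coeff_sub hu (continuous_model _),
        ← ENNReal.ofReal_le_iff_le_toReal hB₀, ofReal_norm]
      exact (ENNReal.le_tsum (f := fun n => ‖coeff (fun x => u x - model (ψ B) x) n‖ₑ) 0).trans hB
    have h4 := norm_sub_norm_le (ψ B).trace (coeff u 0)
    rw [norm_sub_rev] at h4
    linarith
  have hK : IsCompact (Set.univ.pi fun _ : freq d t => Set.univ.pi fun _ : freq d t =>
      Metric.closedBall (0 : ℂ) √R) :=
    isCompact_univ_pi fun _ => isCompact_univ_pi fun _ => isCompact_closedBall _ _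
  have hmem : ∀ B, Φ B ≤ Φ B₀ → B ∈ Set.univ.pi fun _ : freq d t => Set.univ.pi
      fun _ : freq d t => Metric.closedBall (0 : ℂ) √R := fun B hB p _ q _ => by
    simpa using hbound B hB p q
  obtain ⟨B, -, hB⟩ := (hlsc.lowerSemicontinuousOn _).exists_isMinOn ⟨B₀, hmem B₀ le_rfl⟩ hK
  refine ⟨B, fun B' => ?_⟩
  rcases le_total (Φ B') (Φ B₀) with h | h
  · exact hB (hmem B' h)
  · exact (hB (hmem B₀ le_rfl)).trans h

/-! ### Hadamard's formula with `C^r` coefficients -/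

/-- Averages of a `C^n` function along the segments from a fixed point `z` depend in a `C^n` way on
the other end point. The weight `w` is arbitrary because differentiation multiplies it by `τ`. -/
theorem contDiff_integral_segment {E : Type} [NormedAddCommGroup E] [NormedSpace ℝ E]
    [ProperSpace E] (z : E) (n : ℕ) :
    ∀ {F : Type} [NormedAddCommGroup F] [NormedSpace ℝ F] {G : E → F}, ContDiff ℝ n G →
      ∀ {w : ℝ → ℝ}, Continuous w →
        ContDiff ℝ n fun x => ∫ τ in (0 : ℝ)..1, w τ • G (z + τ • (x - z)) := by
  induction n with
  | zero =>
    intro F _ _ G hG w hw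
    have hG' := hG.continuous
    refine contDiff_zero.mpr ?_
    refine intervalIntegral.continuous_parametric_intervalIntegral_of_continuous
      (f := fun x τ => w τ • G (z + τ • (x - z))) ?_ continuous_const
    simp only [Function.uncurry_def]
    fun_prop
  | succ n ih =>
    intro F _ _ G hG w hw
    have hGc := hG.continuous
    have hG1 : ContDiff ℝ n (fderiv ℝ G) := hG.fderiv_right (by norm_cast)
    have hG1c := hG1.continuous
    have hGd : Differentiable ℝ G := hG.differentiable (by norm_cast)
    have hw1 : Continuous fun τ : ℝ => w τ * τ := by fun_prop
    rw [show ((n + 1 : ℕ) : WithTop ℕ∞) = n + 1 by norm_cast, contDiff_succ_iff_hasFDerivAt]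
    refine ⟨_, ih hG1 hw1, fun x₀ => ?_⟩
    have hcont : Continuous fun p : E × ℝ => (w p.2 * p.2) • fderiv ℝ G (z + p.2 • (p.1 - z)) := by
      fun_prop
    obtain ⟨K, hK⟩ := ((isCompact_closedBall x₀ 1).prod (isCompact_Icc (a := (0 : ℝ)) (b := 1))
      ).exists_bound_of_continuousOn hcont.continuousOn
    refine intervalIntegral.hasFDerivAt_integral_of_dominated_of_fderiv_le
      (F' := fun x τ => (w τ * τ) • fderiv ℝ G (z + τ • (x - z)))
      (Metric.closedBall_mem_nhds x₀ one_pos) (bound := fun _ => K) ?_ ?_ ?_ ?_ ?_ ?_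
    · exact Eventually.of_forall fun x => Continuous.aestronglyMeasurable (by fun_prop)
    · exact Continuous.intervalIntegrable (by fun_prop) _ _
    · exact Continuous.aestronglyMeasurable (by fun_prop)
    · refine Eventually.of_forall fun τ hτ x hx => hK (x, τ) ⟨hx, ?_⟩
      rw [Set.uIoc_of_le zero_le_one] at hτ
      exact ⟨hτ.1.le, hτ.2⟩
    · exact continuous_const.intervalIntegrable _ _
    · refine Eventually.of_forall fun τ _ x _ => ?_
      have h1 : HasFDerivAt (fun x : E => z + τ • (x - z)) (τ • ContinuousLinearMap.id ℝ E) x :=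
        (((hasFDerivAt_id x).sub_const z).const_smul τ).const_add z
      have h2 := ((hGd (z + τ • (x - z))).hasFDerivAt.comp x h1).const_smul (w τ)
      refine h2.congr_fderiv ?_
      ext v
      simp [mul_smul]

/-- Taylor's formula at a critical point, with integral remainder. -/
theorem sub_eq_integral_fderiv_fderiv {E : Type*} [NormedAddCommGroup E] [NormedSpace ℝ E]
    {f : E → ℝ} (hf : ContDiff ℝ 2 f) {z : E} (hz : fderiv ℝ f z = 0) (x : E) :
    f x - f z = ∫ τ in (0 : ℝ)..1,
      (1 - τ) • fderiv ℝ (fderiv ℝ f) (z + τ • (x - z)) (x - z) (x - z) := by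
  have hf1 : ContDiff ℝ 1 (fderiv ℝ f) := hf.fderiv_right (by norm_num)
  have hf2 : Continuous (fderiv ℝ (fderiv ℝ f)) := hf1.continuous_fderiv one_ne_zero
  have hline : ∀ τ : ℝ, HasDerivAt (fun τ : ℝ => z + τ • (x - z)) (x - z) τ := fun τ => by
    simpa using ((hasDerivAt_id τ).smul_const (x - z)).const_add z
  have h0 : ∀ τ : ℝ, HasDerivAt (fun τ : ℝ => f (z + τ • (x - z)))
      (fderiv ℝ f (z + τ • (x - z)) (x - z)) τ := fun τ =>
    ((hf.differentiable two_ne_zero _).hasFDerivAt.comp_hasDerivAt τ (hline τ))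
  have h1 : ∀ τ : ℝ, HasDerivAt (fun τ : ℝ => fderiv ℝ f (z + τ • (x - z)) (x - z))
      (fderiv ℝ (fderiv ℝ f) (z + τ • (x - z)) (x - z) (x - z)) τ := fun τ => by
    have h := ((hf1.differentiable one_ne_zero (z + τ • (x - z))).hasFDerivAt.comp_hasDerivAt τ
      (hline τ))
    simpa using h.clm_apply (hasDerivAt_const τ (x - z))
  have hderiv : ∀ τ ∈ Set.uIcc (0 : ℝ) 1, HasDerivAt
      (fun τ : ℝ => f (z + τ • (x - z)) + (1 - τ) * fderiv ℝ f (z + τ • (x - z)) (x - z))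
      ((1 - τ) • fderiv ℝ (fderiv ℝ f) (z + τ • (x - z)) (x - z) (x - z)) τ := fun τ _ => by
    have h := (h0 τ).add (((hasDerivAt_id τ).const_sub 1).mul (h1 τ))
    exact h.congr_deriv (by simp only [id, smul_eq_mul]; ring)
  rw [intervalIntegral.integral_eq_sub_of_hasDerivAt hderiv
    (Continuous.intervalIntegrable (by fun_prop) _ _)]
  simp [hz]

/-! ### Local sums of squares -/

/-- A quadratic form whose matrix is close to a positive diagonal one is diagonally dominant, hence
a combination, with coefficients affine in the matrix, of the squares of `ξᵢ` and `ξᵢ ± ξⱼ`. The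
coefficients on the right are positive when `|Bᵢⱼ| < δ` for `i ≠ j` and `δ · #ι < Bᵢᵢ`. -/
theorem sum_mul_mul_eq_sum_sq {ι : Type*} [Fintype ι] [DecidableEq ι] (B : ι → ι → ℝ)
    (ξ : ι → ℝ) (δ : ℝ) :
    ∑ i, ∑ j, B i j * (ξ i * ξ j) = ∑ i, (B i i - δ * Fintype.card ι) * ξ i ^ 2 +
      (∑ p : ι × ι, (δ + if p.1 = p.2 then 0 else B p.1 p.2) / 4 * (ξ p.1 + ξ p.2) ^ 2 +
        ∑ p : ι × ι, (δ - if p.1 = p.2 then 0 else B p.1 p.2) / 4 * (ξ p.1 - ξ p.2) ^ 2) := by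
  rw [← Finset.sum_add_distrib, Fintype.sum_prod_type]
  have h1 : ∀ i j, (δ + if i = j then 0 else B i j) / 4 * (ξ i + ξ j) ^ 2 +
      (δ - if i = j then 0 else B i j) / 4 * (ξ i - ξ j) ^ 2 =
      δ / 2 * ξ i ^ 2 + δ / 2 * ξ j ^ 2 + (B i j * (ξ i * ξ j) -
        if i = j then B i i * ξ i ^ 2 else 0) := by
    intro i j
    split_ifs with h
    · subst h; ring
    · ring
  simp only [h1, Finset.sum_add_distrib, Finset.sum_sub_distrib, Finset.sum_const,
    Finset.card_univ, nsmul_eq_mul, sub_mul, Finset.sum_ite_eq, Finset.mem_univ, if_true,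
    ← Finset.mul_sum]
  ring

theorem eventually_sum_sq_of_coeff_pos {ι : Type} [Fintype ι] {r : ℕ}
    {lam ell : ι → (Fin d → ℝ) → ℝ} (hlam : ∀ i, ContDiff ℝ r (lam i))
    (hell : ∀ i, ContDiff ℝ r (ell i)) {z : Fin d → ℝ} (hpos : ∀ i, 0 < lam i z) :
    ∀ᶠ x in 𝓝 z, (∀ i, ContDiffAt ℝ r (fun x => √(lam i x) * ell i x) x) ∧
      ∑ i, lam i x * ell i x ^ 2 = ∑ i, (√(lam i x) * ell i x) ^ 2 := by
  have h : ∀ᶠ x in 𝓝 z, ∀ i, 0 < lam i x :=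
    eventually_all.mpr fun i => (hlam i).continuous.continuousAt.eventually (lt_mem_nhds (hpos i))
  filter_upwards [h] with x hx
  refine ⟨fun i => ((hlam i).contDiffAt.sqrt (hx i).ne').mul (hell i).contDiffAt, ?_⟩
  exact Finset.sum_congr rfl fun i _ => by rw [mul_pow, Real.sq_sqrt (hx i).le]

/-- Near a global minimizer with positive definite Hessian, a `C^{r+2}` function minus its minimum
is a finite sum of squares of `C^r` functions. In coordinates orthogonal for the Hessian, the
coefficient matrix of Hadamard's formula is close to a positive diagonal matrix, so that
`sum_mul_mul_eq_sum_sq` applies and no square root of a matrix is needed. -/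
theorem exists_local_sum_sq_of_posDefHessian {r : ℕ} {f : (Fin d → ℝ) → ℝ}
    (hf : ContDiff ℝ (r + 2 : ℕ) f) {z : Fin d → ℝ} (hmin : ∀ x, f z ≤ f x)
    (hpd : PosDefHessian f z) :
    ∃ (ι : Type) (_ : Fintype ι) (h : ι → (Fin d → ℝ) → ℝ), ∀ᶠ x in 𝓝 z,
      (∀ i, ContDiffAt ℝ r (h i) x) ∧ f x - f z = ∑ i, h i x ^ 2 := by
  have hf2 : ContDiff ℝ 2 f := hf.of_le (by norm_cast; omega)
  have hf1 : ContDiff ℝ (r + 1 : ℕ) (fderiv ℝ f) := hf.fderiv_right (by norm_cast)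
  have hH : ContDiff ℝ r (fderiv ℝ (fderiv ℝ f)) := hf1.fderiv_right (by norm_cast)
  have hcrit : fderiv ℝ f z = 0 := IsLocalMin.fderiv_eq_zero (Eventually.of_forall hmin)
  set H := fderiv ℝ (fderiv ℝ f) with hHdef
  let B₀ : LinearMap.BilinForm ℝ (Fin d → ℝ) :=
    LinearMap.mk₂ ℝ (fun v w => H z v w) (by simp) (by simp) (by simp) (by simp)
  have hsymm : LinearMap.IsSymm B₀ :=
    ⟨fun v w => (hf2.contDiffAt.isSymmSndFDerivAt (by simp)).eq v w⟩
  obtain ⟨n, v, hoff⟩ : ∃ (n : ℕ) (v : Module.Basis (Fin n) ℝ (Fin d → ℝ)),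
      ∀ i j, i ≠ j → H z (v i) (v j) = 0 := by
    obtain ⟨v, hv⟩ := LinearMap.BilinForm.exists_orthogonal_basis hsymm
    exact ⟨_, v, fun i j hij => hv hij⟩
  have hdiag : ∀ i, 0 < H z (v i) (v i) := fun i => by
    have h := hpd (v i) (v.ne_zero i)
    rwa [iteratedFDeriv_two_apply] at h
  let B : Fin n → Fin n → (Fin d → ℝ) → ℝ := fun i j x =>
    ∫ τ in (0 : ℝ)..1, (1 - τ) • H (z + τ • (x - z)) (v i) (v j)
  have hB : ∀ i j, ContDiff ℝ r (B i j) := fun i j =>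
    contDiff_integral_segment z r (G := fun y => H y (v i) (v j))
      ((hH.clm_apply contDiff_const).clm_apply contDiff_const) (by fun_prop)
  have hBz : ∀ i j, B i j z = H z (v i) (v j) / 2 := by
    intro i j
    have h1 : ∫ τ in (0 : ℝ)..1, (1 - τ) = 1 / 2 := by
      rw [intervalIntegral.integral_sub intervalIntegrable_const
        (continuous_id'.intervalIntegrable _ _)]
      norm_num
    simp only [B, sub_self, smul_zero, add_zero, smul_eq_mul]
    rw [intervalIntegral.integral_mul_const, h1]
    ring
  let ξ : Fin n → (Fin d → ℝ) → ℝ := fun i x => v.repr (x - z) i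
  have hξ : ∀ i, ContDiff ℝ r (ξ i) := fun i =>
    ((v.coord i).toContinuousLinearMap.contDiff).comp (contDiff_id.sub contDiff_const)
  have htaylor : ∀ x, f x - f z = ∑ i, ∑ j, B i j x * (ξ i x * ξ j x) := by
    intro x
    have hHc := hH.continuous
    have hint : ∀ i j, IntervalIntegrable (fun τ : ℝ =>
        (1 - τ) • H (z + τ • (x - z)) (v i) (v j) * (ξ i x * ξ j x)) volume 0 1 := fun i j =>
      Continuous.intervalIntegrable (by fun_prop) _ _
    have hexp : ∀ y, H y (x - z) (x - z) =
        ∑ i, ∑ j, H y (v i) (v j) * (ξ i x * ξ j x) := by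
      intro y
      conv_lhs => rw [← v.sum_repr (x - z)]
      simp only [map_sum, map_smul, sum_apply, smul_apply, smul_eq_mul, Finset.mul_sum]
      rw [Finset.sum_comm]
      refine Finset.sum_congr rfl fun i _ => Finset.sum_congr rfl fun j _ => ?_
      simp only [ξ]
      ring
    rw [sub_eq_integral_fderiv_fderiv hf2 hcrit x]
    simp only [← hHdef, hexp, smul_eq_mul, Finset.mul_sum, ← mul_assoc]
    simp only [smul_eq_mul, ← mul_assoc] at hint
    rw [intervalIntegral.integral_finsetSum fun i _ => Continuous.intervalIntegrable
      (by fun_prop) _ _]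
    refine Finset.sum_congr rfl fun i _ => ?_
    rw [intervalIntegral.integral_finsetSum fun j _ => hint i j]
    refine Finset.sum_congr rfl fun j _ => ?_
    simp only [B, smul_eq_mul, intervalIntegral.integral_mul_const]
  obtain ⟨δ, hδ0, hδ⟩ : ∃ δ : ℝ, 0 < δ ∧ ∀ i, δ * Fintype.card (Fin n) < B i i z := by
    have h : ∀ᶠ δ : ℝ in 𝓝[>] 0, ∀ i, δ * Fintype.card (Fin n) < B i i z := by
      refine eventually_all.mpr fun i => nhdsWithin_le_nhds ?_
      have hc : ContinuousAt (fun δ : ℝ => δ * Fintype.card (Fin n)) 0 := by fun_prop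
      refine hc.eventually (gt_mem_nhds ?_)
      simp only [hBz, zero_mul]
      exact half_pos (hdiag i)
    obtain ⟨δ, h1, h2⟩ := (h.and self_mem_nhdsWithin).exists
    exact ⟨δ, h2, h1⟩
  let lam : Fin n ⊕ ((Fin n × Fin n) ⊕ (Fin n × Fin n)) → (Fin d → ℝ) → ℝ :=
    Sum.elim (fun i x => B i i x - δ * Fintype.card (Fin n)) (Sum.elim
      (fun p x => (δ + if p.1 = p.2 then 0 else B p.1 p.2 x) / 4)
      (fun p x => (δ - if p.1 = p.2 then 0 else B p.1 p.2 x) / 4))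
  let ell : Fin n ⊕ ((Fin n × Fin n) ⊕ (Fin n × Fin n)) → (Fin d → ℝ) → ℝ :=
    Sum.elim (fun i x => ξ i x) (Sum.elim
      (fun p x => ξ p.1 x + ξ p.2 x) (fun p x => ξ p.1 x - ξ p.2 x))
  have hoffsmooth : ∀ p : Fin n × Fin n,
      ContDiff ℝ r fun x => if p.1 = p.2 then 0 else B p.1 p.2 x := fun p => by
    split_ifs
    · exact contDiff_const
    · exact hB _ _
  have hoffz : ∀ p : Fin n × Fin n, (if p.1 = p.2 then 0 else B p.1 p.2 z) = 0 := fun p => by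
    split_ifs with h
    · rfl
    · rw [hBz, hoff _ _ h, zero_div]
  have hlam : ∀ i, ContDiff ℝ r (lam i) := by
    rintro (i | p | p)
    · exact (hB i i).sub contDiff_const
    · exact (contDiff_const.add (hoffsmooth p)).div_const 4
    · exact (contDiff_const.sub (hoffsmooth p)).div_const 4
  have hell : ∀ i, ContDiff ℝ r (ell i) := by
    rintro (i | p | p)
    · exact hξ i
    · exact (hξ p.1).add (hξ p.2)
    · exact (hξ p.1).sub (hξ p.2)
  have hpos : ∀ i, 0 < lam i z := by
    rintro (i | p | p)
    · exact sub_pos.mpr (hδ i)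
    · simp only [lam, Sum.elim_inr, Sum.elim_inl, hoffz]
      linarith
    · simp only [lam, Sum.elim_inr, hoffz]
      linarith
  refine ⟨_, inferInstance, fun i x => √(lam i x) * ell i x, ?_⟩
  filter_upwards [eventually_sum_sq_of_coeff_pos hlam hell hpos] with x hx
  refine ⟨hx.1, ?_⟩
  rw [htaylor, sum_mul_mul_eq_sum_sq (fun i j => B i j x) (fun i => ξ i x) δ, ← hx.2,
    Fintype.sum_sum_type, Fintype.sum_sum_type]
  rfl

/-- Where `f > c`, the function `f - c` is the square of `√(f - c)`, which is as smooth as `f`. -/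
theorem exists_local_sum_sq_of_lt {r : ℕ} {f : (Fin d → ℝ) → ℝ} (hf : ContDiff ℝ r f) {c : ℝ}
    {z : Fin d → ℝ} (hz : c < f z) :
    ∃ (ι : Type) (_ : Fintype ι) (h : ι → (Fin d → ℝ) → ℝ), ∀ᶠ x in 𝓝 z,
      (∀ i, ContDiffAt ℝ r (h i) x) ∧ f x - c = ∑ i, h i x ^ 2 := by
  refine ⟨Unit, inferInstance, fun _ x => √(f x - c) * 1, ?_⟩
  have h := eventually_sum_sq_of_coeff_pos (ι := Unit) (lam := fun _ x => f x - c)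
    (ell := fun _ _ => 1) (fun _ => hf.sub contDiff_const) (fun _ => contDiff_const) (z := z)
    (fun _ => sub_pos.mpr hz)
  filter_upwards [h] with x hx
  exact ⟨hx.1, by simpa using hx.2⟩

/-! ### Periodization -/

/-- The representative of `x` modulo `ℤ^d` in the unit cube centred at `y`. -/
noncomputable def reduce (y x : Fin d → ℝ) : Fin d → ℝ := fun j => x j - round (x j - y j)

theorem reduce_add (y x : Fin d → ℝ) (k : Fin d → ℤ) :
    reduce y (x + fun j => (k j : ℝ)) = reduce y x := by
  ext j
  simp only [reduce, Pi.add_apply]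
  rw [show x j + k j - y j = x j - y j + k j by ring, round_add_intCast]
  push_cast
  ring

theorem reduce_of_dist_lt {y x : Fin d → ℝ} (h : dist x y < 1 / 2) : reduce y x = x := by
  ext j
  have h1 : |x j - y j| < 1 / 2 := by
    rw [← Real.dist_eq]
    exact (dist_le_pi_dist x y j).trans_lt h
  have h2 : round (x j - y j) = 0 := by
    rw [round_eq, Int.floor_eq_zero_iff]
    rw [abs_lt] at h1
    constructor <;> linarith
  simp [reduce, h2]

theorem exists_reduce_eq_sub (y x : Fin d → ℝ) :
    ∃ k : Fin d → ℤ, x = reduce y x + fun j => (k j : ℝ) :=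
  ⟨fun j => round (x j - y j), by ext j; simp [reduce]⟩

theorem IsPeriodic.apply_reduce {E : Type*} {f : (Fin d → ℝ) → E} (hf : IsPeriodic f)
    (y x : Fin d → ℝ) : f (reduce y x) = f x := by
  obtain ⟨k, hk⟩ := exists_reduce_eq_sub y x
  conv_rhs => rw [hk]
  exact (hf _ _).symm

theorem dist_reduce_le (y x x' : Fin d → ℝ) :
    dist (reduce y x) y ≤ dist x x' + dist (reduce y x') y := by
  refine (dist_pi_le_iff (by positivity)).mpr fun j => ?_
  have h1 : dist (reduce y x j) (y j) = |(x j - y j) - round (x j - y j)| := by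
    rw [Real.dist_eq, reduce]
    congr 1
    ring
  have h2 : dist (reduce y x' j) (y j) = |(x' j - y j) - round (x' j - y j)| := by
    rw [Real.dist_eq, reduce]
    congr 1
    ring
  have h3 := dist_le_pi_dist x x' j
  have h4 := dist_le_pi_dist (reduce y x') y j
  rw [Real.dist_eq] at h3
  rw [h2] at h4
  rw [h1]
  have h5 := round_le (x j - y j) (round (x' j - y j))
  have h6 := abs_add_le (x j - x' j) (x' j - y j - round (x' j - y j))
  rw [show x j - x' j + (x' j - y j - round (x' j - y j)) =
    x j - y j - round (x' j - y j) by ring] at h6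
  linarith

/-- A function vanishing outside a ball of radius less than `1/2` around `y` (in the sup norm)
becomes, composed with `reduce y`, its periodization, which is as smooth as the function. -/
theorem contDiff_comp_reduce {n : ℕ} {w : (Fin d → ℝ) → ℝ} (hw : ContDiff ℝ n w)
    {y : Fin d → ℝ} {ε : ℝ} (hε : ε < 1 / 2) (hsupp : ∀ x, ε ≤ dist x y → w x = 0) :
    ContDiff ℝ n fun x => w (reduce y x) := by
  rw [contDiff_iff_contDiffAt]
  intro x
  rcases lt_or_ge (dist (reduce y x) y) (1 / 2) with h | h
  · -- Near `x` the reduction is a translation.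
    obtain ⟨k, hk⟩ := exists_reduce_eq_sub y x
    have hev : (fun x' => w (reduce y x')) =ᶠ[𝓝 x] fun x' => w (x' - fun j => (k j : ℝ)) := by
      have hc : ContinuousAt (fun x' : Fin d → ℝ => dist (x' - fun j => (k j : ℝ)) y) x := by
        fun_prop
      have hx : dist (x - fun j => (k j : ℝ)) y < 1 / 2 := by
        rwa [sub_eq_of_eq_add hk]
      filter_upwards [hc.eventually (gt_mem_nhds hx)] with x' hx'
      have h1 := reduce_add y (x' - fun j => (k j : ℝ)) k
      rw [sub_add_cancel, reduce_of_dist_lt hx'] at h1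
      rw [h1]
    exact ((hw.comp (contDiff_id.sub contDiff_const)).contDiffAt).congr_of_eventuallyEq hev
  · -- Near `x` the reduction stays outside the support.
    have hev : (fun x' => w (reduce y x')) =ᶠ[𝓝 x] fun _ => 0 := by
      filter_upwards [Metric.ball_mem_nhds x (sub_pos.mpr hε)] with x' hx'
      refine hsupp _ ?_
      have h1 := dist_reduce_le y x x'
      rw [Metric.mem_ball, dist_comm] at hx'
      linarith
    exact contDiffAt_const.congr_of_eventuallyEq hev

/-! ### Global sums of squares -/

/-- There is a periodic `C^r` weight `ω ≥ 0`, positive on `V`, such that `ω f` is a sum of squares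
of periodic `C^r` functions. -/
def HasWeightedSumSq (r : ℕ) (f : (Fin d → ℝ) → ℝ) (V : Set (Fin d → ℝ)) : Prop :=
  ∃ (ι : Type) (_ : Fintype ι) (h : ι → (Fin d → ℝ) → ℝ) (ω : (Fin d → ℝ) → ℝ),
    (∀ i, IsPeriodic (h i)) ∧ (∀ i, ContDiff ℝ r (h i)) ∧ IsPeriodic ω ∧ ContDiff ℝ r ω ∧
      (∀ x, 0 ≤ ω x) ∧ (∀ x ∈ V, 0 < ω x) ∧ ∀ x, ω x * f x = ∑ i, h i x ^ 2

theorem HasWeightedSumSq.union {r : ℕ} {f : (Fin d → ℝ) → ℝ} {V W : Set (Fin d → ℝ)}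
    (hV : HasWeightedSumSq r f V) (hW : HasWeightedSumSq r f W) :
    HasWeightedSumSq r f (V ∪ W) := by
  obtain ⟨ι, _, h, ω, hp, hs, hωp, hωs, hω0, hωV, hsum⟩ := hV
  obtain ⟨ι', _, h', ω', hp', hs', hωp', hωs', hω0', hωV', hsum'⟩ := hW
  refine ⟨ι ⊕ ι', inferInstance, Sum.elim h h', fun x => ω x + ω' x, ?_, ?_, ?_, hωs.add hωs',
    fun x => add_nonneg (hω0 x) (hω0' x), ?_, fun x => ?_⟩
  · rintro (i | i)
    exacts [hp i, hp' i]
  · rintro (i | i)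
    exacts [hs i, hs' i]
  · intro x k
    simp only [hωp x k, hωp' x k]
  · rintro x (hx | hx)
    · exact add_pos_of_pos_of_nonneg (hωV x hx) (hω0' x)
    · exact add_pos_of_nonneg_of_pos (hω0 x) (hωV' x hx)
  · rw [add_mul, hsum, hsum', Fintype.sum_sum_type]
    rfl

theorem exists_nhds_hasWeightedSumSq {r : ℕ} {f : (Fin d → ℝ) → ℝ} (hf : IsPeriodic f)
    {y : Fin d → ℝ} {ι : Type} [Fintype ι] {h : ι → (Fin d → ℝ) → ℝ}
    (hloc : ∀ᶠ x in 𝓝 y, (∀ i, ContDiffAt ℝ r (h i) x) ∧ f x = ∑ i, h i x ^ 2) :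
    ∃ V ∈ 𝓝 y, HasWeightedSumSq r f V := by
  obtain ⟨ρ, hρ0, hρ⟩ := Metric.eventually_nhds_iff.mp hloc
  set ε := min (ρ / 2) (1 / 4) with hε
  have hε0 : 0 < ε := lt_min (half_pos hρ0) (by norm_num)
  have hερ : ε < ρ := (min_le_left _ _).trans_lt (half_lt_self hρ0)
  have hε2 : ε < 1 / 2 := (min_le_right _ _).trans_lt (by norm_num)
  let ψ : ContDiffBump y := ⟨ε / 2, ε, half_pos hε0, half_lt_self hε0⟩
  have hψ : ContDiff ℝ r ψ := ψ.contDiff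
  have hψ0 : ∀ x, ε ≤ dist x y → ψ x = 0 := fun x hx => ψ.zero_of_le_dist hx
  have hw : ∀ i, ContDiff ℝ r fun x => ψ x * h i x := by
    intro i
    rw [contDiff_iff_contDiffAt]
    intro x
    by_cases hx : dist x y < ρ
    · exact hψ.contDiffAt.mul ((hρ hx).1 i)
    · refine contDiffAt_const (c := (0 : ℝ)).congr_of_eventuallyEq ?_
      have hc : ContinuousAt (fun x' : Fin d → ℝ => dist x' y) x := by fun_prop
      filter_upwards [hc.eventually (lt_mem_nhds (hερ.trans_le (not_lt.mp hx)))] with x' hx'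
      rw [hψ0 x' hx'.le, zero_mul]
  have hsum : ∀ x, ψ x ^ 2 * f x = ∑ i, (ψ x * h i x) ^ 2 := by
    intro x
    by_cases hx : dist x y < ρ
    · rw [(hρ hx).2, Finset.mul_sum]
      simp only [mul_pow]
    · simp [hψ0 x (hερ.le.trans (not_lt.mp hx))]
  refine ⟨Metric.ball y ε, Metric.ball_mem_nhds y hε0, ι, inferInstance,
    fun i x => ψ (reduce y x) * h i (reduce y x), fun x => ψ (reduce y x) ^ 2,
    fun i x k => by simp only [reduce_add],
    fun i => contDiff_comp_reduce (hw i) hε2 fun x hx => by rw [hψ0 x hx, zero_mul],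
    fun x k => by simp only [reduce_add],
    (contDiff_comp_reduce hψ hε2 hψ0).pow 2, fun x => sq_nonneg _, fun x hx => ?_, fun x => ?_⟩
  · have h1 : dist x y < ε := hx
    simp only [reduce_of_dist_lt (h1.trans hε2)]
    exact pow_pos (ψ.pos_of_mem_ball hx) 2
  · rw [← hsum, hf.apply_reduce]

/-- A periodic `C^{r+2}` function whose Hessian is positive definite at its minimizers equals its
minimum plus a finite sum of squares of periodic `C^r` functions. -/
theorem exists_sum_sq {r : ℕ} {f : (Fin d → ℝ) → ℝ} (hper : IsPeriodic f)
    (hf : ContDiff ℝ (r + 2 : ℕ) f) {c : ℝ} (hc : IsLeast (Set.range f) c)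
    (hhess : ∀ x ∈ minimizers f, PosDefHessian f x) :
    ∃ (ι : Type) (_ : Fintype ι) (h : ι → (Fin d → ℝ) → ℝ),
      (∀ i, IsPeriodic (h i)) ∧ (∀ i, ContDiff ℝ r (h i)) ∧ ∀ x, f x - c = ∑ i, h i x ^ 2 := by
  have hge : ∀ x, c ≤ f x := fun x => hc.2 ⟨x, rfl⟩
  have hper' : IsPeriodic fun x => f x - c := fun x k => by simp only [hper x k]
  have hcube : HasWeightedSumSq r (fun x => f x - c) (cube d) := by
    refine isCompact_cube.induction_on ?_ ?_ (fun _ _ => HasWeightedSumSq.union) fun y hy => ?_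
    · exact ⟨Empty, inferInstance, fun i => i.elim, fun _ => 0, fun i => i.elim, fun i => i.elim,
        fun _ _ => rfl, contDiff_const, fun _ => le_rfl, fun x hx => hx.elim, by simp⟩
    · rintro V W hVW ⟨ι, _, h, ω, h1, h2, h3, h4, h5, h6, h7⟩
      exact ⟨ι, inferInstance, h, ω, h1, h2, h3, h4, h5, fun x hx => h6 x (hVW hx), h7⟩
    · suffices h : ∃ V ∈ 𝓝 y, HasWeightedSumSq r (fun x => f x - c) V by
        obtain ⟨V, hV, h⟩ := h
        exact ⟨V, mem_nhdsWithin_of_mem_nhds hV, h⟩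
      rcases (hge y).lt_or_eq with hlt | heq
      · obtain ⟨ι, _, h, hloc⟩ :=
          exists_local_sum_sq_of_lt (hf.of_le (m := r) (by norm_cast; omega)) hlt
        exact exists_nhds_hasWeightedSumSq hper' hloc
      · subst heq
        obtain ⟨ι, _, h, hloc⟩ :=
          exists_local_sum_sq_of_posDefHessian hf hge (hhess y ⟨hy, fun x _ => hge x⟩)
        exact exists_nhds_hasWeightedSumSq hper' hloc
  obtain ⟨ι, _, h, ω, hp, hs, hωp, hωs, -, hω, hsum⟩ := hcube
  have hpos : ∀ x, 0 < ω x := by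
    intro x
    obtain ⟨y, hy, k, rfl⟩ := exists_mem_cube x
    rw [hωp]
    exact hω y hy
  refine ⟨ι, inferInstance, fun i x => h i x / √(ω x), fun i x k => ?_, fun i => ?_, fun x => ?_⟩
  · simp only [hp i x k, hωp x k]
  · exact (hs i).div (hωs.sqrt fun x => (hpos x).ne') fun x => (Real.sqrt_pos.mpr (hpos x)).ne'
  · simp only [div_pow, Real.sq_sqrt (hpos x).le, ← Finset.sum_div]
    rw [← hsum x, mul_div_cancel_left₀ _ (hpos x).ne']

end PeriodicPSD

open PeriodicPSD in
theorem theorem3 (d : ℕ) (m : ℝ) (hm : 0 < m) (f : (Fin d → ℝ) → ℝ)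
    (hper : PeriodicPSD.IsPeriodic f)
    (hf : ContDiff ℝ (⌈m + (d : ℝ) / 2 + 2⌉₊ : ℕ) f)
    (c : ℝ) (hc : IsLeast (Set.range f) c)
    (hfin : (PeriodicPSD.minimizers f).Finite)
    (hhess : ∀ x ∈ PeriodicPSD.minimizers f, PeriodicPSD.PosDefHessian f x) :
    ∃ C : ℝ, 0 < C ∧ ∀ t : ℕ,
      ∃ g ∈ PeriodicPSD.psdModels d t,
        (∀ g' ∈ PeriodicPSD.psdModels d t,
          PeriodicPSD.fNorm (fun x => ((f x - c : ℝ) : ℂ) - g x) ≤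
            PeriodicPSD.fNorm (fun x => ((f x - c : ℝ) : ℂ) - g' x)) ∧
        (1 ≤ t →
          PeriodicPSD.fNorm (fun x => ((f x - c : ℝ) : ℂ) - g x) ≤
            ENNReal.ofReal (C * (t : ℝ) ^ (-m))) := by
  set r := ⌈m + (d : ℝ) / 2⌉₊
  have hr : m + (d : ℝ) / 2 ≤ r := Nat.le_ceil _
  have hf' : ContDiff ℝ (r + 2 : ℕ) f := by
    rwa [Nat.ceil_add_ofNat (by positivity)] at hf
  obtain ⟨ι, _, h, hp, hs, hsum⟩ := exists_sum_sq hper hf' hc hhess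
  let H : ι → (Fin d → ℝ) → ℂ := fun i x => (h i x : ℂ)
  have hHp : ∀ i, IsPeriodic (H i) := fun i x k => by simp only [H, hp i x k]
  have hHs : ∀ i, ContDiff ℝ r (H i) := fun i => Complex.ofRealCLM.contDiff.comp (hs i)
  have hsq := fun i => (hHp i).summable_sq_norm_pow_mul_coeff (hHs i)
  have hfin' := fun i => tsum_enorm_ne_top hm hr (hsq i)
  have hser : ∀ i x, HasSum (fun k => coeff (H i) k * e (-k) x) (H i x) := fun i =>
    (hHp i).hasSum_coeff (hHs i).continuous (summable_enorm_iff.mp (hfin' i))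
  choose K hK0 hK using fun i => exists_tail_le hm hr (hsq i)
  have hfc : ∀ x, ((f x - c : ℝ) : ℂ) = ∑ i, H i x * star (H i x) := by
    intro x
    rw [hsum]
    push_cast
    refine Finset.sum_congr rfl fun i _ => ?_
    simp only [H, RCLike.star_def, Complex.conj_ofReal, sq]
  have hcont : Continuous fun x => ((f x - c : ℝ) : ℂ) :=
    Complex.continuous_ofReal.comp (hf.continuous.sub continuous_const)
  set S : ι → ℝ := fun i => (∑' k, ‖coeff (H i) k‖ₑ).toReal with hS
  have hS0 : ∀ i, 0 ≤ S i := fun i => ENNReal.toReal_nonneg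
  have hSK : 0 ≤ ∑ i, 2 * S i * K i :=
    Finset.sum_nonneg fun i _ => mul_nonneg (mul_nonneg zero_le_two (hS0 i)) (hK0 i)
  refine ⟨∑ i, 2 * S i * K i + 1, by linarith, fun t => ?_⟩
  obtain ⟨g, hg, hmin⟩ := exists_model_minimizing hcont t
  refine ⟨g, hg, hmin, fun ht => ?_⟩
  obtain ⟨g', hg', hle⟩ := exists_model_near_sum_sq hfin' hser t
  refine (hmin g' hg').trans ?_
  simp only [hfc]
  refine hle.trans ?_
  have hterm : ∀ i, 2 * (∑' k, ‖coeff (H i) k‖ₑ) *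
      ∑' k, (if k ∈ freq d t then 0 else ‖coeff (H i) k‖ₑ) ≤
      ENNReal.ofReal (2 * S i * K i * (t : ℝ) ^ (-m)) := by
    intro i
    rw [mul_assoc (2 * S i), ENNReal.ofReal_mul (by have := hS0 i; positivity),
      ENNReal.ofReal_mul zero_le_two, hS, ENNReal.ofReal_toReal (hfin' i), ENNReal.ofReal_ofNat]
    gcongr
    exact hK i t ht
  refine (Finset.sum_le_sum fun i _ => hterm i).trans ?_
  rw [← ENNReal.ofReal_sum_of_nonneg fun i _ => mul_nonneg
    (mul_nonneg (mul_nonneg zero_le_two (hS0 i)) (hK0 i)) (by positivity), ← Finset.sum_mul]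
  gcongr
  linarith
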